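/- Let $p$ be a prime and let $(R,\mathfrak m)$ be a Noetherian normal local domain of characteristic $p$. Recall that $R$ is a splinter if for every module-finite ring extension $R\subseteq T$ the inclusion $R\to T$ splits as a map of $R$-modules, and that $R$ is strongly $F$-regular if it is $F$-finite (that is, its Frobenius endomorphism is module-finite) and for every $0\neq c\in R$ there are $e>0$ and an $R$-linear map $\varphi: F^e_*R\to R$ with $\varphi(F^e_*(cR))=R$. (a) If $R$ is strongly $F$-regular, then $R$ is a splinter. (b) If $R$ is a splinter (for instance, if $R$ is strongly $F$-regular), then there is no module-finite local extension $(R,\mathfrak m)\subseteq (S,\mathfrak n)$ with $S$ a normal local domain, with corresponding fraction fields $K\subseteq L$, such that all of the following hold: 1. the residue fields are equal, i.e. the induced map $R/\mathfrak m\to S/\mathfrak n$ is an isomorphism; 2. $p$ divides $[L:K]$; 3. $R\subseteq S$ is étale in codimension $1$, i.e. étale at every prime ideal of $S$ of height at most $1$. -/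

import Mathlib

/-- A commutative ring `R` is a *splinter* if every module-finite ring extension `R ⊆ S` splits as
a map of `R`-modules, i.e. `R` is a direct summand of `S`. (A module-finite extension of `R` always
has a copy in the universe of `R`, so quantifying over that universe loses nothing.) -/
def IsSplinter.{u} (R : Type u) [CommRing R] : Prop :=
  ∀ (S : Type u) [CommRing S] [Algebra R S] [Module.Finite R S],
    Function.Injective (algebraMap R S) →
      ∃ ρ : S →ₗ[R] R, ρ ∘ₗ Algebra.linearMap R S = LinearMap.id

/-- The `R`-linear maps `F^e_* R → R`, for `R` of prime characteristic `p`. Here `F^e_* R` is the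
additive group `R` on which `a : R` acts as multiplication by `a ^ p ^ e`. -/
structure FrobeniusPushforwardHom (p e : ℕ) (R : Type*) [CommRing R] extends R →+ R where
  map_frobenius_smul' : ∀ a x : R, toFun (a ^ p ^ e * x) = a * toFun x

/-- A ring `R` of prime characteristic `p` is *`F`-finite* if its Frobenius endomorphism
is module-finite. -/
def IsFFinite (p : ℕ) [Fact p.Prime] (R : Type*) [CommRing R] [CharP R p] : Prop :=
  (frobenius R p).Finite

/-- A domain `R` of prime characteristic `p` is *strongly `F`-regular* if it is `F`-finite and for
every nonzero `c : R` there are `e > 0` and an `R`-linear map `φ : F^e_* R → R` with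
`φ (F^e_* (c R)) = R`. -/
def IsStronglyFRegular (p : ℕ) [Fact p.Prime] (R : Type*) [CommRing R] [IsDomain R] [CharP R p] :
    Prop :=
  IsFFinite p R ∧ ∀ c : R, c ≠ 0 → ∃ e : ℕ, 0 < e ∧ ∃ φ : FrobeniusPushforwardHom p e R,
    φ.toFun '' (Ideal.span {c} : Set R) = Set.univ

/-- An extension `R ⊆ S` is *étale in codimension 1* if it is étale at every prime
of `S` of height at most one. For a module-finite `S` over a Noetherian `R`, `Algebra.IsEtaleAt R Q`
(formal étaleness of `S_Q` over `R`) is étaleness of `R → S` at `Q`. -/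
def IsEtaleInCodimOne (R S : Type*) [CommRing R] [CommRing S] [Algebra R S] : Prop :=
  ∀ (Q : Ideal S) [Q.IsPrime], Q.height ≤ 1 → Algebra.IsEtaleAt R Q

/-! (a) Take `ψ : S → R` with `ψ 1 ≠ 0` and a `p⁻ᵉ`-linear `φ` with `φ (r ψ(1)) = 1`; then `s ↦ φ (r
ψ(s ^ p ^ e))` retracts `S` onto `R`.

(b) Étaleness in codimension one forces every `R`-linear `ρ : S → R` to be `Tr(s · -)` for some `s ∈
S`: separability gives `s ∈ L`, and as `S` is normal, membership in `S` is tested at primes of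
height at most one, where the different is trivial. For a retraction `ρ` this gives `Tr(s) = 1`.
Equal residue fields allow `s = r + x` with `r ∈ R`, `x ∈ 𝔫`. But `Tr(r) = [L:K] r = 0` since `p ∣
[L:K]`, and `Tr(𝔫) ⊆ 𝔪`, so `1 ∈ 𝔪`, a contradiction. -/

/-! ### Strong F-regularity and splinters -/

/-- A nonzero module-finite extension of a Noetherian domain carries a functional that does not
vanish at `1`. -/
theorem exists_linearMap_apply_one_ne_zero (R S : Type*) [CommRing R] [IsDomain R]
    [IsNoetherianRing R] [CommRing S] [Algebra R S] [Module.Finite R S]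
    (h : Function.Injective (algebraMap R S)) : ∃ ψ : S →ₗ[R] R, ψ 1 ≠ 0 := by
  let K := FractionRing R
  have hv : (1 : K) ⊗ₜ[R] (1 : S) ≠ 0 := by
    have := Module.Flat.lTensor_preserves_injective_linearMap (M := K) (Algebra.linearMap R S) h
    have h1 : (1 : K) ⊗ₜ[R] (1 : R) ≠ 0 := fun h0 ↦ by
      simpa using congrArg (TensorProduct.rid R K) h0
    simpa using (map_ne_zero_iff _ this).mpr h1
  obtain ⟨φ, hφ⟩ : ∃ φ : Module.Dual K (TensorProduct R K S), φ (1 ⊗ₜ 1) ≠ 0 := by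
    by_contra! H
    exact hv ((Module.forall_dual_apply_eq_zero_iff K _).mp H)
  have : Module.FinitePresentation R S := Module.finitePresentation_of_finite R S
  -- Clearing denominators: some multiple `b φ` maps the finitely presented module `S` into `R`.
  obtain ⟨ψ, b, hψ⟩ := Module.FinitePresentation.exists_lift_of_isLocalizedModule
    (nonZeroDivisors R) (Algebra.linearMap R K)
    (φ.restrictScalars R ∘ₗ TensorProduct.mk R K S 1)
  refine ⟨ψ, fun h0 ↦ ?_⟩
  have := LinearMap.congr_fun hψ 1
  simp only [LinearMap.coe_comp, Function.comp_apply, h0, map_zero] at this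
  have h2 : algebraMap R K b * φ (1 ⊗ₜ 1) = 0 := by
    rw [← Algebra.smul_def]; exact this.symm
  exact (mul_ne_zero (IsFractionRing.to_map_ne_zero_of_mem_nonZeroDivisors b.2) hφ) h2

/-- A strongly `F`-regular Noetherian domain is a splinter. -/
theorem IsStronglyFRegular.isSplinter {p : ℕ} [Fact p.Prime] {R : Type*} [CommRing R] [IsDomain R]
    [IsNoetherianRing R] [CharP R p] (hR : IsStronglyFRegular p R) : IsSplinter R := by
  intro S _ _ _ hinj
  have : CharP S p := charP_of_injective_algebraMap hinj p
  obtain ⟨ψ, hψ⟩ := exists_linearMap_apply_one_ne_zero R S hinj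
  obtain ⟨e, -, φ, hφ⟩ := hR.2 _ hψ
  obtain ⟨y, hy, hy1⟩ := hφ.ge (Set.mem_univ (1 : R))
  obtain ⟨r, rfl⟩ := Ideal.mem_span_singleton'.mp hy
  refine ⟨{ toFun s := φ.toFun (r * ψ (s ^ p ^ e)), map_add' x y := ?_, map_smul' a x := ?_ }, ?_⟩
  · rw [add_pow_char_pow, map_add, mul_add]; exact φ.map_add' _ _
  · rw [smul_pow, map_smul, smul_eq_mul, mul_left_comm]
    exact φ.map_frobenius_smul' _ _
  · ext
    simpa using hy1

/-- A splinter is a direct summand of module-finite extensions in any universe. -/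
theorem IsSplinter.exists_retraction {R : Type*} [CommRing R] (hR : IsSplinter R)
    (S : Type*) [CommRing S] [Algebra R S] [Module.Finite R S]
    (h : Function.Injective (algebraMap R S)) : ∃ ρ : S →ₗ[R] R, ρ 1 = 1 := by
  obtain ⟨n, f, hf⟩ := Module.Finite.exists_fin' R S
  have : Small S := small_of_surjective hf
  let e : Shrink S ≃ₐ[R] S := Shrink.algEquiv R S
  have : Module.Finite R (Shrink S) := Module.Finite.equiv e.symm.toLinearEquiv
  obtain ⟨ρ, hρ⟩ := hR (Shrink S) (by
    have := e.symm.injective.comp h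
    convert! this using 1)
  refine ⟨ρ ∘ₗ e.symm.toLinearMap, ?_⟩
  simpa using LinearMap.congr_fun hρ 1

/-! ### Traces of elements of the maximal ideal -/

open Polynomial in
/-- The lower coefficients of the minimal polynomial of an element of the maximal ideal of a local
ring `S`, integral over the normal local domain `R`, lie in the maximal ideal of `R`. -/
theorem minpoly_coeff_mem_maximalIdeal {R S : Type*} [CommRing R] [IsDomain R] [IsLocalRing R]
    [IsIntegrallyClosed R] [CommRing S] [IsDomain S] [IsLocalRing S] [Algebra R S]
    [Algebra.IsIntegral R S] [FaithfulSMul R S] {x : S} (hx : x ∈ IsLocalRing.maximalIdeal S)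
    {i : ℕ} (hi : i ≠ (minpoly R x).natDegree) :
    (minpoly R x).coeff i ∈ IsLocalRing.maximalIdeal R := by
  -- By integrality, the only prime of `S` containing `𝔪S` is the maximal ideal.
  obtain ⟨n, hn⟩ : x ∈ ((IsLocalRing.maximalIdeal R).map (algebraMap R S)).radical := by
    rw [Ideal.radical_eq_sInf, Submodule.mem_sInf]
    rintro P ⟨hle, hP⟩
    have hmax : (Ideal.comap (algebraMap R S) P).IsMaximal := by
      rw [← (IsLocalRing.maximalIdeal.isMaximal R).eq_of_le
        (Ideal.IsPrime.ne_top inferInstance) (Ideal.map_le_iff_le_comap.mp hle)]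
      infer_instance
    have := Ideal.isMaximal_of_isIntegral_of_isMaximal_comap P hmax
    rwa [IsLocalRing.eq_maximalIdeal this]
  -- `f(X ^ (n + 1))` kills `x` and is a power of `X` modulo `𝔪`, hence so is its monic divisor
  -- `minpoly R x`. The exponent `n + 1` is positive, as `expand` requires.
  obtain ⟨f, hfm, hfx, hf⟩ := exists_monic_aeval_eq_zero_forall_mem_of_mem_map
    (pow_succ x n ▸ Ideal.mul_mem_right x _ hn)
  have hdvd : minpoly R x ∣ expand R (n + 1) f :=
    minpoly.isIntegrallyClosed_dvd (Algebra.IsIntegral.isIntegral _) (by rwa [expand_aeval])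
  have hrad := coeff_mem_radical_span_coeff_of_dvd _ _ (hfm.expand n.succ_pos)
    (minpoly.monic (Algebra.IsIntegral.isIntegral _)) hdvd i hi
  refine (Ideal.IsPrime.isRadical inferInstance) (Ideal.radical_mono ?_ hrad)
  rw [Ideal.span_le]
  rintro _ ⟨j, hj, rfl⟩
  rw [natDegree_expand] at hj
  rw [SetLike.mem_coe, coeff_expand n.succ_pos]
  split_ifs with h
  · refine hf _ (ne_of_lt ?_)
    exact Nat.div_lt_of_lt_mul (by rwa [mul_comm])
  · exact zero_mem _

/-- The trace of an element of the maximal ideal of a normal local module-finite extension lies in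
the maximal ideal of the base. -/
theorem exists_mem_maximalIdeal_algebraMap_eq_trace {R S : Type*} [CommRing R] [IsDomain R]
    [IsLocalRing R] [IsIntegrallyClosed R] [CommRing S] [IsDomain S] [IsLocalRing S] [Algebra R S]
    [Algebra.IsIntegral R S] [FaithfulSMul R S] (K L : Type*) [Field K] [Field L] [Algebra R K]
    [IsFractionRing R K] [Algebra S L] [Algebra K L] [Algebra R L]
    [IsScalarTower R K L] [IsScalarTower R S L] [FiniteDimensional K L]
    {x : S} (hx : x ∈ IsLocalRing.maximalIdeal S) :
    ∃ y ∈ IsLocalRing.maximalIdeal R, algebraMap R K y = Algebra.trace K L (algebraMap S L x) := by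
  have hint : IsIntegral R x := Algebra.IsIntegral.isIntegral x
  rw [trace_eq_finrank_mul_minpoly_nextCoeff, minpoly.isIntegrallyClosed_eq_field_fractions K L hint,
    Polynomial.nextCoeff_map (IsFractionRing.injective R K)]
  refine ⟨(Module.finrank (IntermediateField.adjoin K {algebraMap S L x}) L : R) *
    -(minpoly R x).nextCoeff, Ideal.mul_mem_left _ _ (neg_mem ?_), by
    rw [map_mul, map_neg, map_natCast]⟩
  have hpos := minpoly.natDegree_pos hint
  rw [Polynomial.nextCoeff_of_natDegree_pos hpos]
  exact minpoly_coeff_mem_maximalIdeal hx (by omega)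

/-! ### Denominators at primes of height at most one -/

/-- An element of the fraction field outside a Noetherian normal domain `S` has a denominator ideal
contained in a prime of height at most one. -/
theorem exists_height_le_one_of_notMem_range (S L : Type*) [CommRing S] [IsDomain S]
    [IsNoetherianRing S] [IsIntegrallyClosed S] [Field L] [Algebra S L] [IsFractionRing S L]
    {s : L} (hs : s ∉ (algebraMap S L).range) :
    ∃ Q : Ideal S, Q.IsPrime ∧ Q.height ≤ 1 ∧
      ∀ d : S, algebraMap S L d * s ∈ (algebraMap S L).range → d ∈ Q := by
  let N : Submodule S L := LinearMap.range (Algebra.linearMap S L)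
  have hN (x : L) : x ∈ N ↔ x ∈ (algebraMap S L).range := Iff.rfl
  have hs' : N.mkQ s ≠ 0 := by
    rwa [ne_eq, Submodule.mkQ_apply, Submodule.Quotient.mk_eq_zero]
  -- `Q` is an associated prime of `L / S`, the annihilator of the class of some `t`.
  obtain ⟨Q, hQa, hle⟩ := exists_le_isAssociatedPrime_of_isNoetherianRing S _ hs'
  obtain ⟨hQ, y, hy⟩ := Submodule.isAssociatedPrime_iff.mp hQa
  obtain ⟨t, rfl⟩ := N.mkQ_surjective y
  have key (x : L) (d : S) : d ∈ (⊥ : Submodule S (L ⧸ N)).colon {N.mkQ x} ↔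
      algebraMap S L d * x ∈ (algebraMap S L).range := by
    rw [Submodule.mem_colon_singleton, Submodule.mem_bot, ← map_smul, Submodule.mkQ_apply,
      Submodule.Quotient.mk_eq_zero, hN, Algebra.smul_def]
  have hQt (d : S) : d ∈ Q ↔ algebraMap S L d * t ∈ (algebraMap S L).range := by
    rw [← key, ← hy]
  refine ⟨Q, hQ, ?_, fun d hd ↦ hle ((key _ _).mpr hd)⟩
  have hinj := IsFractionRing.injective S L
  have ht : t ∉ (algebraMap S L).range := fun h ↦
    hQ.ne_top ((Ideal.eq_top_iff_one _).mpr ((hQt 1).mpr (by simpa using h)))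
  -- If `tQ ⊆ Q`, then `t` is integral over `S`, so lies in `S`. Otherwise `b = at ∉ Q` makes `Q`
  -- minimal over `(a)`, and Krull's principal ideal theorem applies.
  obtain ⟨a, haQ, b, hb, hbQ⟩ : ∃ a ∈ Q, ∃ b, algebraMap S L b = algebraMap S L a * t ∧ b ∉ Q := by
    by_contra! H
    have hQ0 : Q ≠ ⊥ := by
      rintro rfl
      obtain ⟨a, b, hb, rfl⟩ := IsFractionRing.div_surjective (A := S) t
      have hb0 := nonZeroDivisors.ne_zero hb
      refine hb0 ((hQt b).mpr ⟨a, ?_⟩)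
      rw [mul_div_cancel₀]
      exact (map_ne_zero_iff _ hinj).mpr hb0
    refine ht (IsIntegrallyClosed.isIntegral_iff.mp (isIntegral_of_smul_mem_submodule
      (Submodule.map (Algebra.linearMap S L) Q) ?_ ((IsNoetherian.noetherian Q).map _) t ?_))
    · rwa [ne_eq, (Submodule.map_injective_of_injective (f := Algebra.linearMap S L) hinj).eq_iff' (Submodule.map_bot _)]
    · rintro _ ⟨a, ha, rfl⟩
      obtain ⟨b, hb⟩ := (hQt a).mp ha
      refine ⟨b, H a ha b hb, ?_⟩
      rw [Algebra.linearMap_apply, hb, smul_eq_mul, mul_comm, Algebra.linearMap_apply]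
  refine (Ideal.span {a}).height_le_one_of_isPrincipal_of_mem_minimalPrimes Q
    ⟨⟨hQ, by simpa [Ideal.span_le] using haQ⟩, fun P' ⟨hP', haP'⟩ hle' c hc ↦ ?_⟩
  obtain ⟨e, he⟩ := (hQt c).mp hc
  have : b * c = a * e := hinj (by rw [map_mul, map_mul, hb, he]; ring)
  have hbc : b * c ∈ P' := this ▸ P'.mul_mem_right _ (haP' (Ideal.mem_span_singleton_self a))
  refine (hP'.mem_or_mem hbc).resolve_left fun hbP ↦ hbQ (hle' hbP)

/-- In an extension of Dedekind domains, elements of the trace dual have denominators outside any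
given unramified prime. -/
theorem exists_notMem_mul_mem_range_of_isUnramifiedAt {A B : Type*} [CommRing A] [CommRing B]
    [Algebra A B] [IsDedekindDomain A] [IsDedekindDomain B] [Module.IsTorsionFree A B]
    [Module.Finite A B] (K L : Type*) [Field K] [Field L] [Algebra A K] [IsFractionRing A K]
    [Algebra B L] [IsFractionRing B L] [Algebra K L] [Algebra A L] [IsScalarTower A K L]
    [IsScalarTower A B L] [FiniteDimensional K L] [Algebra.IsSeparable K L] {s : L}
    (hs : ∀ b : B, Algebra.trace K L (s * algebraMap B L b) ∈ (algebraMap A K).range)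
    (P : Ideal B) [P.IsPrime] [hP : Algebra.IsUnramifiedAt A P] :
    ∃ d ∉ P, algebraMap B L d * s ∈ (algebraMap B L).range := by
  let : Algebra (FractionRing A) (FractionRing B) := FractionRing.liftAlgebra A (FractionRing B)
  have H : RingHom.comp (algebraMap (FractionRing A) (FractionRing B))
      ↑(FractionRing.algEquiv A K).symm.toRingEquiv =
        RingHom.comp ↑(FractionRing.algEquiv B L).symm.toRingEquiv (algebraMap K L) := by
    apply IsLocalization.ringHom_ext (nonZeroDivisors A)
    ext
    simp only [RingHom.coe_comp, RingHom.coe_coe,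
      AlgEquiv.coe_ringEquiv, Function.comp_apply, AlgEquiv.commutes,
      ← IsScalarTower.algebraMap_apply]
    rw [IsScalarTower.algebraMap_apply A B L, AlgEquiv.commutes, ← IsScalarTower.algebraMap_apply]
  have : Algebra.IsSeparable (FractionRing A) (FractionRing B) :=
    Algebra.IsSeparable.of_equiv_equiv _ _ H
  have : IsIntegralClosure B A L := IsIntegralClosure.of_isIntegrallyClosed B A L
  -- The different is the inverse of the trace dual and avoids unramified primes; any `d` in it
  -- outside `P` works.
  have hle : ¬ differentIdeal A B ≤ P := fun h ↦
    not_dvd_differentIdeal_iff.mpr hP (Ideal.dvd_iff_le.mpr h)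
  obtain ⟨d, hd, hdP⟩ := SetLike.not_le_iff_exists.mp hle
  refine ⟨d, hdP, ?_⟩
  have hmem : algebraMap B L d ∈ IsLocalization.coeSubmodule L (differentIdeal A B) :=
    ⟨d, hd, rfl⟩
  rw [coeSubmodule_differentIdeal A K, Submodule.mem_div_iff_forall_mul_mem] at hmem
  have := hmem s (Submodule.mem_traceDual.mpr fun a ha ↦ by
    obtain ⟨b, rfl⟩ := Submodule.mem_one.mp ha
    exact hs b)
  exact Submodule.mem_one.mp this

/-- In an extension of Noetherian normal domains, elements of the trace dual have denominators
outside any given unramified prime of height at most one. -/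
theorem exists_notMem_mul_mem_range_of_height_le_one {R S : Type*} [CommRing R] [IsDomain R]
    [IsNoetherianRing R] [IsIntegrallyClosed R] [CommRing S] [IsDomain S] [IsIntegrallyClosed S]
    [Algebra R S] [Module.Finite R S] [FaithfulSMul R S]
    (K L : Type*) [Field K] [Field L] [Algebra R K] [IsFractionRing R K]
    [Algebra S L] [IsFractionRing S L] [Algebra K L] [Algebra R L] [IsScalarTower R K L]
    [IsScalarTower R S L] [FiniteDimensional K L] [Algebra.IsSeparable K L] {s : L}
    (hs : ∀ b : S, Algebra.trace K L (s * algebraMap S L b) ∈ (algebraMap R K).range)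
    (Q : Ideal S) [Q.IsPrime] (hQ : Q.height ≤ 1) [Algebra.IsUnramifiedAt R Q] :
    ∃ d ∉ Q, algebraMap S L d * s ∈ (algebraMap S L).range := by
  have : IsNoetherianRing S := IsNoetherianRing.of_finite R S
  let q := Q.under R
  let M := Algebra.algebraMapSubmonoid S q.primeCompl
  let A := Localization.AtPrime q
  let B := Localization M
  have hq : q.height ≤ 1 := by
    -- Going down holds because `R` is normal.
    rw [Ideal.height_eq_height_add_of_liesOver_of_hasGoingDown q Q] at hQ
    exact le_self_add.trans hQ
  have hM : M ≤ nonZeroDivisors S :=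
    map_le_nonZeroDivisors_of_injective _ (FaithfulSMul.algebraMap_injective R S)
      q.primeCompl_le_nonZeroDivisors
  have hMQ {m : S} (hm : m ∈ M) : m ∉ Q := by
    obtain ⟨r, hr, rfl⟩ := hm
    exact hr
  let : Algebra A B := localizationAlgebra q.primeCompl S
  have : IsScalarTower R A B := .of_algebraMap_eq fun x ↦ by
    rw [IsScalarTower.algebraMap_apply R S B]
    exact (IsLocalization.map_eq _ x).symm
  have : IsDomain A := IsLocalization.isDomain_localization q.primeCompl_le_nonZeroDivisors
  have : IsDomain B := IsLocalization.isDomain_localization hM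
  have : Module.Finite A B := Module.Finite.of_isLocalization R S q.primeCompl
  have : IsIntegrallyClosed A :=
    isIntegrallyClosed_of_isLocalization A q.primeCompl q.primeCompl_le_nonZeroDivisors
  have : IsIntegrallyClosed B := isIntegrallyClosed_of_isLocalization B M hM
  have : Ring.KrullDimLE 1 A := by
    rw [Ring.krullDimLE_iff, IsLocalization.AtPrime.ringKrullDim_eq_height q A]
    exact_mod_cast hq
  have : Ring.DimensionLEOne A :=
    ⟨fun {_} h0 hp ↦ Ring.krullDimLE_one_iff_of_isPrime_bot.mp ‹_› _ h0 hp⟩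
  have : IsDedekindDomain A := { }
  let : Algebra A K := (IsLocalization.lift (M := q.primeCompl) (g := algebraMap R K)
    fun y ↦ IsUnit.mk0 _ (IsFractionRing.to_map_ne_zero_of_mem_nonZeroDivisors
      (q.primeCompl_le_nonZeroDivisors y.2))).toAlgebra
  let : Algebra B L := (IsLocalization.lift (M := M) (g := algebraMap S L)
    fun y ↦ IsUnit.mk0 _ (IsFractionRing.to_map_ne_zero_of_mem_nonZeroDivisors (hM y.2))).toAlgebra
  let : Algebra A L := ((algebraMap K L).comp (algebraMap A K)).toAlgebra
  have : IsScalarTower R A K := .of_algebraMap_eq fun x ↦ (IsLocalization.lift_eq _ x).symm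
  have : IsScalarTower S B L := .of_algebraMap_eq fun x ↦ (IsLocalization.lift_eq _ x).symm
  have : IsScalarTower A K L := .of_algebraMap_eq' rfl
  have : IsScalarTower A B L := by
    refine .of_algebraMap_eq' (IsLocalization.ringHom_ext q.primeCompl ?_)
    ext x
    simp only [RingHom.comp_apply]
    rw [← IsScalarTower.algebraMap_apply R A B, IsScalarTower.algebraMap_apply R S B,
      ← IsScalarTower.algebraMap_apply S B L, IsScalarTower.algebraMap_apply A K L,
      ← IsScalarTower.algebraMap_apply R A K, ← IsScalarTower.algebraMap_apply R K L,
      ← IsScalarTower.algebraMap_apply R S L]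
  have : IsFractionRing A K := IsFractionRing.isFractionRing_of_isDomain_of_isLocalization
    q.primeCompl A K
  have : IsFractionRing B L := IsFractionRing.isFractionRing_of_isDomain_of_isLocalization M B L
  have : IsIntegralClosure B A L := IsIntegralClosure.of_isIntegrallyClosed B A L
  have : IsDedekindDomain B := IsIntegralClosure.isDedekindDomain A K L B
  have : Module.IsTorsionFree A B := by
    have : FaithfulSMul A L := (faithfulSMul_iff_algebraMap_injective A L).mpr
      ((algebraMap K L).injective.comp (IsFractionRing.injective A K))
    have : FaithfulSMul A B := FaithfulSMul.tower_bot A B L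
    infer_instance
  have hdisj : Disjoint (M : Set S) Q := Set.disjoint_left.mpr fun _ ↦ hMQ
  let P := Q.map (algebraMap S B)
  have : P.IsPrime := IsLocalization.isPrime_of_isPrime_disjoint M B Q ‹_› hdisj
  have hPQ : P.comap (algebraMap S B) = Q :=
    IsLocalization.under_map_of_isPrime_disjoint M B ‹_› hdisj
  -- `B_P = S_Q`, so unramifiedness at `Q` over `R` becomes unramifiedness at `P` over `A`.
  have : IsLocalization.AtPrime (Localization.AtPrime P) Q := by
    have := IsLocalization.isLocalization_isLocalization_atPrime_isLocalization M
      (Localization.AtPrime P) P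
    convert! this
    exact hPQ.symm
  have : Algebra.IsUnramifiedAt A P := by
    have : Algebra.FormallyUnramified R (Localization.AtPrime P) :=
      Algebra.FormallyUnramified.of_equiv ((IsLocalization.algEquiv Q.primeCompl
        (Localization.AtPrime Q) (Localization.AtPrime P)).restrictScalars R)
    exact Algebra.FormallyUnramified.of_restrictScalars R A _
  have hB (b : B) : Algebra.trace K L (s * algebraMap B L b) ∈ (algebraMap A K).range := by
    obtain ⟨⟨b₁, _, r, hr, rfl⟩, h₁⟩ := IsLocalization.surj M b
    obtain ⟨a, ha⟩ := hs b₁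
    replace h₁ := congrArg (algebraMap B L) h₁
    simp only [map_mul, ← IsScalarTower.algebraMap_apply S B L] at h₁
    have h₂ : algebraMap R K r * Algebra.trace K L (s * algebraMap B L b) = algebraMap R K a := by
      rw [← smul_eq_mul, ← map_smul, ha, ← h₁, Algebra.smul_def,
        ← IsScalarTower.algebraMap_apply R K L, ← IsScalarTower.algebraMap_apply R S L]
      congr 1
      ring
    have hr0 : algebraMap R K r ≠ 0 := IsFractionRing.to_map_ne_zero_of_mem_nonZeroDivisors
      (q.primeCompl_le_nonZeroDivisors hr)
    refine ⟨IsLocalization.mk' A a ⟨r, hr⟩, mul_left_cancel₀ hr0 ?_⟩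
    rw [h₂, IsScalarTower.algebraMap_apply R A K, ← map_mul, IsLocalization.mk'_spec'_mk,
      ← IsScalarTower.algebraMap_apply R A K]
  obtain ⟨d, hd, c, hc⟩ := exists_notMem_mul_mem_range_of_isUnramifiedAt (A := A) K L
    (s := s) hB P
  obtain ⟨⟨d₁, m₁⟩, h₁⟩ := IsLocalization.surj M d
  obtain ⟨⟨c₂, m₂⟩, h₂⟩ := IsLocalization.surj M c
  replace hh₁ := congrArg (algebraMap B L) h₁
  replace h₂ := congrArg (algebraMap B L) h₂
  have hd₁ : d₁ ∉ Q := fun h ↦ hd <| by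
    have := h₁ ▸ Ideal.mem_map_of_mem (algebraMap S B) h
    exact (Ideal.mul_unit_mem_iff_mem P (IsLocalization.map_units B m₁)).mp this
  refine ⟨m₂ * d₁, fun h ↦ ?_, m₁ * c₂, ?_⟩
  · exact ((‹Q.IsPrime›.mem_or_mem h).resolve_left (hMQ m₂.2)) |> hd₁
  · simp only [map_mul, ← IsScalarTower.algebraMap_apply S B L] at hh₁ h₂ ⊢
    rw [← hh₁, ← h₂, hc]
    ring

/-! ### The trace generates `Hom_R(S, R)` -/

/-- A normal domain `S` étale in codimension one over `R` has a separable fraction field. -/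
theorem IsEtaleInCodimOne.isSeparable {R S : Type*} [CommRing R] [IsDomain R]
    [CommRing S] [IsDomain S] [Algebra R S]
    (K L : Type*) [Field K] [Field L] [Algebra R K] [Algebra S L] [IsFractionRing S L]
    [Algebra K L] [Algebra R L] [IsScalarTower R K L] [IsScalarTower R S L]
    [FiniteDimensional K L] (h : IsEtaleInCodimOne R S) : Algebra.IsSeparable K L := by
  -- The zero ideal has height zero and its localization is `L`.
  have := h ⊥ (by simp)
  have : IsLocalization.AtPrime L (⊥ : Ideal S) := by
    have hbot : (⊥ : Ideal S).primeCompl = nonZeroDivisors S := by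
      ext; simp [Ideal.primeCompl]
    rw [IsLocalization.AtPrime, hbot]
    infer_instance
  have : Algebra.FormallyUnramified R L :=
    Algebra.FormallyUnramified.of_equiv ((IsLocalization.algEquiv (⊥ : Ideal S).primeCompl
      (Localization.AtPrime (⊥ : Ideal S)) L).restrictScalars R)
  rw [← Algebra.FormallyUnramified.iff_isSeparable]
  exact Algebra.FormallyUnramified.of_restrictScalars R K L

/-- If `S` is étale in codimension one over the Noetherian normal domain `R`, then the trace
generates `Hom_R(S, R)` as an `S`-module. -/
theorem IsEtaleInCodimOne.exists_trace_mul_eq {R S : Type*} [CommRing R] [IsDomain R]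
    [IsNoetherianRing R] [IsIntegrallyClosed R] [CommRing S] [IsDomain S] [IsIntegrallyClosed S]
    [Algebra R S] [Module.Finite R S] [FaithfulSMul R S]
    (K L : Type*) [Field K] [Field L] [Algebra R K] [IsFractionRing R K]
    [Algebra S L] [IsFractionRing S L] [Algebra K L] [Algebra R L] [IsScalarTower R K L]
    [IsScalarTower R S L] [FiniteDimensional K L] (h : IsEtaleInCodimOne R S) (ρ : S →ₗ[R] R) :
    ∃ s : S, ∀ x : S, Algebra.trace K L (algebraMap S L (s * x)) = algebraMap R K (ρ x) := by
  have : IsNoetherianRing S := IsNoetherianRing.of_finite R S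
  have := h.isSeparable K L
  have : IsIntegralClosure S R L := IsIntegralClosure.of_isIntegrallyClosed S R L
  have := IsIntegralClosure.isLocalization R K L S
  have : IsLocalizedModule (nonZeroDivisors R) (IsScalarTower.toAlgHom R S L).toLinearMap :=
    isLocalizedModule_iff_isLocalization.mpr this
  let ρL : Module.Dual K L := IsLocalizedModule.mapExtendScalars (nonZeroDivisors R)
    (IsScalarTower.toAlgHom R S L).toLinearMap (Algebra.linearMap R K) K ρ
  have hρ (x : S) : ρL (algebraMap S L x) = algebraMap R K (ρ x) :=
    IsLocalizedModule.map_apply (nonZeroDivisors R)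
      (IsScalarTower.toAlgHom R S L).toLinearMap (Algebra.linearMap R K) ρ x
  obtain ⟨s, hs⟩ := ((Algebra.traceForm K L).toDual (traceForm_nondegenerate K L)).surjective ρL
  have hs' (y : L) : Algebra.trace K L (s * y) = ρL y := by
    rw [← hs, LinearMap.BilinForm.toDual_def, Algebra.traceForm_apply]
  obtain ⟨t, rfl⟩ : s ∈ (algebraMap S L).range := by
    by_contra hmem
    obtain ⟨Q, _, hQ1, hQ⟩ := exists_height_le_one_of_notMem_range S L hmem
    have := h Q hQ1
    obtain ⟨d, hd, hds⟩ := exists_notMem_mul_mem_range_of_height_le_one (R := R) K L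
      (fun b ↦ ⟨ρ b, by rw [hs', hρ]⟩) Q hQ1
    exact hd (hQ d hds)
  exact ⟨t, fun x ↦ by rw [map_mul, hs', hρ]⟩

/-! ### Conclusion -/

theorem mainTheorem10 (p : ℕ) [Fact p.Prime]
    (R : Type*) [CommRing R] [IsDomain R] [IsNoetherianRing R] [IsLocalRing R]
    [IsIntegrallyClosed R] [CharP R p] :
    (IsStronglyFRegular p R → IsSplinter R) ∧
    (IsSplinter R →
      ∀ (S : Type*) [CommRing S] [IsDomain S] [IsLocalRing S] [IsIntegrallyClosed S]
        [Algebra R S] [Module.Finite R S] [IsLocalHom (algebraMap R S)]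
        (K L : Type*) [Field K] [Field L] [Algebra R K] [IsFractionRing R K]
        [Algebra S L] [IsFractionRing S L] [Algebra K L] [Algebra R L]
        [IsScalarTower R K L] [IsScalarTower R S L],
        Function.Injective (algebraMap R S) →
        ¬ (Function.Bijective
              (algebraMap (IsLocalRing.ResidueField R) (IsLocalRing.ResidueField S)) ∧
            p ∣ Module.finrank K L ∧
            IsEtaleInCodimOne R S)) := by
  refine ⟨IsStronglyFRegular.isSplinter, fun hR S _ _ _ _ _ _ _ K L _ _ _ _ _ _ _ _ _ _ hinj
    ⟨hres, hp, het⟩ ↦ ?_⟩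
  have : FaithfulSMul R S := (faithfulSMul_iff_algebraMap_injective R S).mpr hinj
  have : FiniteDimensional K L := by
    have : IsIntegralClosure S R L := IsIntegralClosure.of_isIntegrallyClosed S R L
    have : Algebra.IsAlgebraic K L := isAlgebraic_of_isFractionRing R S K L
    have := IsIntegralClosure.isLocalization R K L S
    exact .of_isLocalization R S (nonZeroDivisors R)
  obtain ⟨ρ, hρ⟩ := hR.exists_retraction S hinj
  obtain ⟨s, hs⟩ := het.exists_trace_mul_eq K L ρ
  obtain ⟨k, hk⟩ := hres.2 (IsLocalRing.residue S s)
  obtain ⟨r, rfl⟩ := IsLocalRing.residue_surjective k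
  have hx : s - algebraMap R S r ∈ IsLocalRing.maximalIdeal S := by
    rw [← IsLocalRing.residue_eq_zero_iff, map_sub, ← hk, sub_eq_zero]
    rfl
  obtain ⟨y, hy, hxy⟩ := exists_mem_maximalIdeal_algebraMap_eq_trace (R := R) K L hx
  have : CharP K p := charP_of_injective_algebraMap (IsFractionRing.injective R K) p
  have h0 : Algebra.trace K L (algebraMap S L (algebraMap R S r)) = 0 := by
    rw [← IsScalarTower.algebraMap_apply, IsScalarTower.algebraMap_apply R K L,
      Algebra.trace_algebraMap, nsmul_eq_mul, (CharP.cast_eq_zero_iff K p _).mpr hp, zero_mul]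
  have h1 : algebraMap R K y = algebraMap R K 1 := by
    rw [hxy, map_sub, map_sub, h0, sub_zero, ← hρ, ← hs, mul_one]
  rw [IsFractionRing.injective R K h1] at hy
  exact (Ideal.ne_top_iff_one _).mp (IsLocalRing.maximalIdeal.isMaximal R).ne_top hy
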